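/- Let $\mathcal M$ be the set of Borel probability measures on $\mathbb R^D$ with finite second moment, with the Wasserstein distance $W_2(\mu,\nu)=\big(\inf_{\gamma\in\Gamma(\mu,\nu)}\int|x-y|^2\,d\gamma\big)^{1/2}$, where $\Gamma(\mu,\nu)$ is the set of couplings of $\mu$ and $\nu$; let $\Gamma_o(\mu,\nu)$ be the set of couplings attaining the infimum. Let $L^2(\mu)$ be the Hilbert space of $\mu$-square-integrable vector fields on $\mathbb R^D$, with norm $\|\cdot\|_\mu$. A pseudo 1-form $\bar\Lambda$ assigns to each $\mu\in\mathcal M$ a continuous linear functional $\bar\Lambda_\mu$ on $L^2(\mu)$; write $\bar\Lambda_\mu(X)=\int\langle\bar A_\mu,X\rangle\,d\mu$ with $\bar A_\mu\in L^2(\mu)$. It is called regular if there is a constant $c>0$ such that for every $\mu\in\mathcal M$ there exist a Borel field $B_\mu\in L^\infty(\mu)$ of $D\times D$ matrices with $\|B_\mu\|_\mu\le c$ and a function $O_\mu\in C(\mathbb R)$ with $O_\mu(0)=0$ such that for all $\nu\in\mathcal M$ $$\sup_{\gamma\in\Gamma_o(\mu,\nu)}\int|\bar A_\nu(y)-\bar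 A_\mu(x)-B_\mu(x)(y-x)|^2\,d\gamma(x,y)\le W_2^2(\mu,\nu)\,\min\{O_\mu(W_2(\mu,\nu)),c\}^2 ,$$ where $\|B_\mu\|_\mu=\big(\int |B_\mu|^2d\mu\big)^{1/2}$, $|\cdot|$ being the operator norm. Let $a,b\in\mathbb R$ and let $\sigma\in AC_2(a,b;\mathcal M)$, i.e. $\sigma:(a,b)\to\mathcal M$ and there is $\beta\in L^2(a,b)$ with $W_2(\sigma_t,\sigma_s)\le\int_s^t\beta(\tau)\,d\tau$ for all $a<s<t<b$. Let $v$ be a velocity for $\sigma$: a Borel map $v:(a,b)\times\mathbb R^D\to\mathbb R^D$ with $v_t\in L^2(\sigma_t)$ for almost every $t$ and $\int_a^b\int(\partial_t\varphi+d\varphi(v_t))\,d\sigma_t\,dt=0$ for all $\varphi\in C_c^\infty((a,b)\times\mathbb R^D)$. Suppose that $t\mapsto\|v_t\|_{\sigma_t}$ is square integrable on $(a,b)$. Then, for every regular pseudo 1-form $\bar\Lambda$ on $\mathcal M$, the function $t\mapsto\bar\Lambda_{\sigma_t}(v_t)$ (set to $0$ on the null set of those $t$ with $v_t\notin L^2(\sigma_t)$)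 is Borel measurable and square integrable on $(a,b)$. In particular it is integrable, so that the line integral $\int_a^b\bar\Lambda_{\sigma_t}(v_t)\,dt$ of $\bar\Lambda$ along $(\sigma,v)$ is well defined. -/

import Mathlib

open MeasureTheory Set
open scoped ENNReal

noncomputable section

namespace WassersteinForms

/-- The Euclidean space of dimension `D`. -/
abbrev Euc (D : ℕ) : Type := EuclideanSpace ℝ (Fin D)

/-- Borel probability measures with finite second moment. -/
def PM2 (D : ℕ) : Type :=
  {μ : Measure (Euc D) // IsProbabilityMeasure μ ∧ ∫⁻ x, ‖x‖ₑ ^ 2 ∂μ < ∞}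

/-- The underlying measure. -/
def PM2.meas {D : ℕ} (μ : PM2 D) : Measure (Euc D) := μ.1

/-- Couplings: measures on the product with marginals `μ` and `ν`. -/
def Couplings {D : ℕ} (μ ν : PM2 D) : Set (Measure (Euc D × Euc D)) :=
  {γ | γ.map Prod.fst = μ.meas ∧ γ.map Prod.snd = ν.meas}

/-- The quadratic transport cost of a plan. -/
def cost {D : ℕ} (γ : Measure (Euc D × Euc D)) : ℝ≥0∞ :=
  ∫⁻ p, ‖p.1 - p.2‖ₑ ^ 2 ∂γ

/-- The quadratic Wasserstein distance. The infimum is finite, since the product coupling has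
finite cost. -/
def W2 {D : ℕ} (μ ν : PM2 D) : ℝ :=
  Real.sqrt (⨅ γ ∈ Couplings μ ν, cost γ).toReal

/-- Optimal couplings: the minimizers of the transport cost among all couplings. -/
def OptCouplings {D : ℕ} (μ ν : PM2 D) : Set (Measure (Euc D × Euc D)) :=
  {γ | γ ∈ Couplings μ ν ∧ ∀ γ' ∈ Couplings μ ν, cost γ ≤ cost γ'}

/-- A pseudo 1-form: a section `μ ↦ Λ μ ∈ L²(μ)*` of the pseudo cotangent bundle. -/
def PseudoOneForm (D : ℕ) : Type :=
  (μ : PM2 D) → StrongDual ℝ (Lp (Euc D) 2 μ.meas)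

/-- The Riesz representative `A_μ ∈ L²(μ)` of `Λ_μ`, so that `Λ_μ(X) = ∫ ⟨A_μ, X⟩ dμ`. -/
def PseudoOneForm.field {D : ℕ} (Λ : PseudoOneForm D) (μ : PM2 D) : Lp (Euc D) 2 μ.meas :=
  (InnerProductSpace.toDual ℝ (Lp (Euc D) 2 μ.meas)).symm (Λ μ)

open Classical in
/-- The value `Λ_μ(X)` for a vector field `X` in `L²(μ)`; it is set to `0` for other fields. -/
def PseudoOneForm.eval {D : ℕ} (Λ : PseudoOneForm D) (μ : PM2 D) (X : Euc D → Euc D) : ℝ :=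
  if h : MemLp X 2 μ.meas then Λ μ (h.toLp X) else 0

/-- Regular pseudo 1-forms. Matrices are identified with linear maps. -/
def PseudoOneForm.IsRegular {D : ℕ} (Λ : PseudoOneForm D) : Prop :=
  ∃ c : ℝ, 0 < c ∧ ∀ μ : PM2 D, ∃ (B : Euc D → (Euc D →L[ℝ] Euc D)) (O : ℝ → ℝ),
    Measurable B ∧ MemLp B ∞ μ.meas ∧ eLpNorm B 2 μ.meas ≤ ENNReal.ofReal c ∧
    Continuous O ∧ O 0 = 0 ∧
    ∀ ν : PM2 D, ∀ γ ∈ OptCouplings μ ν,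
      ∫⁻ p, ‖Λ.field ν p.2 - Λ.field μ p.1 - B p.1 (p.2 - p.1)‖ₑ ^ 2 ∂γ
        ≤ ENNReal.ofReal (W2 μ ν ^ 2 * (min (O (W2 μ ν)) c) ^ 2)

/-- 2-absolutely continuous curves on `(a,b)`. -/
def IsAC2 {D : ℕ} (a b : ℝ) (σ : ℝ → PM2 D) : Prop :=
  ∃ β : ℝ → ℝ, MemLp β 2 (volume.restrict (Ioo a b)) ∧
    ∀ s t : ℝ, a < s → s < t → t < b → W2 (σ t) (σ s) ≤ ∫ τ in s..t, β τ

/-- The space-time integrand of the weak continuity equation, integrated in space: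
`∫ (∂φ/∂t + dφ(X_t)) dσ_t`. -/
def continuityIntegrand {D : ℕ} (σ : ℝ → PM2 D) (X : ℝ → Euc D → Euc D)
    (φ : ℝ × Euc D → ℝ) (t : ℝ) : ℝ :=
  ∫ x, (fderiv ℝ φ (t, x) (1, 0) + fderiv ℝ φ (t, x) (0, X t x)) ∂(σ t).meas

/-- `∂σ/∂t + div_σ(X) = 0` on `(a,b)`, in the sense of distributions. -/
def ContinuityEquation {D : ℕ} (a b : ℝ) (σ : ℝ → PM2 D) (X : ℝ → Euc D → Euc D) : Prop :=
  ∀ φ : ℝ × Euc D → ℝ, ContDiff ℝ ((⊤ : ℕ∞) : WithTop ℕ∞) φ → HasCompactSupport φ →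
    tsupport φ ⊆ Ioo a b ×ˢ univ →
      IntegrableOn (continuityIntegrand σ X φ) (Ioo a b) ∧
        ∫ t in Ioo a b, continuityIntegrand σ X φ t = 0

/-- `v` is a velocity for the curve `σ` on `(a,b)`. -/
structure IsVelocity {D : ℕ} (a b : ℝ) (σ : ℝ → PM2 D) (v : ℝ → Euc D → Euc D) : Prop where
  borel : Measurable fun p : Ioo a b × Euc D => v p.1 p.2
  memLp : ∀ᵐ t ∂(volume.restrict (Ioo a b)), MemLp (v t) 2 (σ t).meas
  continuity : ContinuityEquation a b σ v

end WassersteinForms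

end

/-!
A regular form `Λ` has a field `A μ ∈ L²(μ)` which is Lipschitz at each `μ` along optimal couplings
`γ` of `μ` and `ν`: the `L²(γ)` norm of `A ν y - A μ x` is at most `C * W2 μ ν` as long as `W2 μ ν`
stays bounded (`PseudoOneForm.IsRegular.exists_eLpNorm_sub_le`). Indeed `B μ` is essentially bounded
and the continuous modulus `O μ` is bounded on bounded intervals. To use this for all `ν`, optimal
couplings have to exist; this is the direct method, with Prokhorov's theorem for compactness
(`exists_mem_optCouplings`).

An absolutely continuous curve `σ` on a bounded interval is continuous for `W2` and stays in a ball.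
Therefore `‖A (σ t)‖` is bounded along the curve, and `|Λ (σ t) (v t)| ≤ C ‖v t‖` is square
integrable as soon as it is measurable.

For the measurability, the Lipschitz estimate makes `t ↦ ∫ φ • A (σ t) ∂(σ t)` continuous for every
bounded Lipschitz `φ` (`TransportContinuous.continuous_integral_smul`). Approximating indicators of
closed sets by such `φ`, a π-λ argument shows that `t ↦ ∫ x in S_t, A (σ t) x ∂(σ t)` is measurable
for every measurable set `S` of space-time with sections `S_t`
(`TransportContinuous.measurable_setIntegral`). The constant section `1` is covered as well, so
`t ↦ σ t` is a kernel and the set of `t` with `v t ∈ L²(σ t)` is Borel. On that set, `v` is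
approximated by simple functions dominated by `2 ‖v‖`.
-/

open Filter Topology
open scoped NNReal BoundedContinuousFunction

namespace WassersteinForms

/-! ### Existence of optimal couplings -/

/-- The integral of a nonnegative continuous function is lower semicontinuous for weak
convergence, being the supremum of the integrals of its bounded truncations. -/
lemma lowerSemicontinuous_lintegral_probabilityMeasure {X : Type*} [TopologicalSpace X]
    [MeasurableSpace X] [OpensMeasurableSpace X] {f : X → ℝ≥0} (hf : Continuous f) :
    LowerSemicontinuous fun μ : ProbabilityMeasure X => ∫⁻ x, f x ∂(μ : Measure X) := by
  let g (n : ℕ) : X →ᵇ ℝ≥0 := BoundedContinuousFunction.mkOfBound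
    ⟨fun x => min (f x) n, hf.min continuous_const⟩ n fun x y => by
      rw [NNReal.dist_eq]
      exact abs_sub_le_of_nonneg_of_le (NNReal.coe_nonneg _) (mod_cast min_le_right _ _)
        (NNReal.coe_nonneg _) (mod_cast min_le_right _ _)
  have hfg : (fun μ : ProbabilityMeasure X => ∫⁻ x, f x ∂(μ : Measure X))
      = fun μ : ProbabilityMeasure X => ⨆ n, ∫⁻ x, g n x ∂(μ : Measure X) := by
    ext μ
    rw [← lintegral_iSup (fun n => by fun_prop)]
    · refine lintegral_congr fun x => ?_
      refine le_antisymm ?_ (iSup_le fun n => ?_)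
      · obtain ⟨n, hn⟩ := exists_nat_ge (f x)
        exact le_iSup_of_le n (by simp [g, hn])
      · simp [g]
    · intro m n hmn x
      simp only [g]
      gcongr
      exact min_le_min_left _ (by exact_mod_cast hmn)
  rw [hfg]
  exact lowerSemicontinuous_iSup fun n =>
    (ProbabilityMeasure.continuous_lintegral_boundedContinuousFunction (g n)).lowerSemicontinuous

variable {D : ℕ}

instance (μ : PM2 D) : IsProbabilityMeasure μ.meas := μ.2.1

lemma isProbabilityMeasure_of_mem_couplings {μ ν : PM2 D} {γ : Measure (Euc D × Euc D)}
    (h : γ ∈ Couplings μ ν) : IsProbabilityMeasure γ := by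
  have : IsProbabilityMeasure (γ.map Prod.fst) := by rw [h.1]; infer_instance
  exact Measure.isProbabilityMeasure_of_map Prod.fst

lemma prod_mem_couplings (μ ν : PM2 D) : μ.meas.prod ν.meas ∈ Couplings μ ν := by
  constructor <;> simp

/-- The couplings of two measures form a compact set: it is closed as the fibre of the continuous
map to the marginals, and tight since its marginals are fixed. -/
lemma isCompact_setOf_coe_mem_couplings (μ ν : PM2 D) :
    IsCompact {γ : ProbabilityMeasure (Euc D × Euc D) |
      (γ : Measure (Euc D × Euc D)) ∈ Couplings μ ν} := by
  have hclosed :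
      IsClosed {γ : ProbabilityMeasure (Euc D × Euc D) |
        (γ : Measure (Euc D × Euc D)) ∈ Couplings μ ν} := by
    have h1 := (isClosed_singleton (X := ProbabilityMeasure (Euc D))
      (x := ⟨μ.meas, inferInstance⟩)).preimage
      (ProbabilityMeasure.continuous_map (continuous_fst (X := Euc D) (Y := Euc D)))
    have h2 := (isClosed_singleton (X := ProbabilityMeasure (Euc D))
      (x := ⟨ν.meas, inferInstance⟩)).preimage
      (ProbabilityMeasure.continuous_map (continuous_snd (X := Euc D) (Y := Euc D)))
    convert h1.inter h2 using 1
    ext γ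
    exact ⟨fun h => ⟨Subtype.ext h.1, Subtype.ext h.2⟩,
      fun h => ⟨congrArg Subtype.val h.1, congrArg Subtype.val h.2⟩⟩
  rw [← hclosed.closure_eq]
  refine isCompact_closure_of_isTightMeasureSet ?_
  refine IsTightMeasureSet.prodMk ?_ ?_
  · refine (isTightMeasureSet_singleton (μ := μ.meas)).subset ?_
    rintro _ ⟨_, ⟨γ, hγ, rfl⟩, rfl⟩
    exact hγ.1
  · refine (isTightMeasureSet_singleton (μ := ν.meas)).subset ?_
    rintro _ ⟨_, ⟨γ, hγ, rfl⟩, rfl⟩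
    exact hγ.2

/-- The direct method: a lower semicontinuous cost on a nonempty compact set has a minimizer. -/
lemma exists_mem_optCouplings (μ ν : PM2 D) : ∃ γ, γ ∈ OptCouplings μ ν := by
  have hlsc : LowerSemicontinuous
      fun γ : ProbabilityMeasure (Euc D × Euc D) => cost (γ : Measure (Euc D × Euc D)) := by
    have := lowerSemicontinuous_lintegral_probabilityMeasure
      (f := fun p : Euc D × Euc D => ‖p.1 - p.2‖₊ ^ 2) (by fun_prop)
    simpa [cost, enorm] using this
  obtain ⟨γ, hγ, hmin⟩ := (hlsc.lowerSemicontinuousOn _).exists_isMinOn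
    (s := {γ : ProbabilityMeasure (Euc D × Euc D) | (γ : Measure (Euc D × Euc D)) ∈ Couplings μ ν})
    ⟨⟨_, inferInstance⟩, prod_mem_couplings μ ν⟩ (isCompact_setOf_coe_mem_couplings μ ν)
  refine ⟨(γ : Measure (Euc D × Euc D)), hγ, fun γ' hγ' => ?_⟩
  have := isProbabilityMeasure_of_mem_couplings hγ'
  exact hmin (a := ⟨γ', this⟩) hγ'

/-! ### The Wasserstein distance as an `L²` norm -/

lemma eLpNorm_two_sq {α E : Type*} [MeasurableSpace α] [NormedAddCommGroup E] (f : α → E)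
    (μ : Measure α) : eLpNorm f 2 μ ^ 2 = ∫⁻ x, ‖f x‖ₑ ^ 2 ∂μ := by
  have := eLpNorm_nnreal_pow_eq_lintegral (f := f) (μ := μ) (p := 2) two_ne_zero
  simpa using this

lemma memLp_id (μ : PM2 D) : MemLp (fun x : Euc D => x) 2 μ.meas := by
  refine ⟨by fun_prop, ?_⟩
  have h : eLpNorm (fun x : Euc D => x) 2 μ.meas ^ 2 < ∞ := by
    rw [eLpNorm_two_sq]; exact μ.2.2
  simpa using h

lemma measurePreserving_fst {μ ν : PM2 D} {γ : Measure (Euc D × Euc D)}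
    (h : γ ∈ Couplings μ ν) : MeasurePreserving Prod.fst γ μ.meas := ⟨measurable_fst, h.1⟩

lemma measurePreserving_snd {μ ν : PM2 D} {γ : Measure (Euc D × Euc D)}
    (h : γ ∈ Couplings μ ν) : MeasurePreserving Prod.snd γ ν.meas := ⟨measurable_snd, h.2⟩

lemma eLpNorm_snd_sub_fst_sq (γ : Measure (Euc D × Euc D)) :
    eLpNorm (fun p : Euc D × Euc D => p.2 - p.1) 2 γ ^ 2 = cost γ := by
  rw [eLpNorm_two_sq, cost]
  refine lintegral_congr fun p => ?_
  rw [← enorm_neg, neg_sub]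

lemma memLp_snd_sub_fst {μ ν : PM2 D} {γ : Measure (Euc D × Euc D)} (h : γ ∈ Couplings μ ν) :
    MemLp (fun p : Euc D × Euc D => p.2 - p.1) 2 γ :=
  ((memLp_id ν).comp_measurePreserving (measurePreserving_snd h)).sub
    ((memLp_id μ).comp_measurePreserving (measurePreserving_fst h))

/-- `W2` is the `L²` norm of the displacement under an optimal coupling; no junk value arises from
`toReal`, since the second moments make the cost of every coupling finite. -/
lemma eLpNorm_snd_sub_fst_of_mem_optCouplings {μ ν : PM2 D} {γ : Measure (Euc D × Euc D)}
    (h : γ ∈ OptCouplings μ ν) :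
    eLpNorm (fun p : Euc D × Euc D => p.2 - p.1) 2 γ = ENNReal.ofReal (W2 μ ν) := by
  have hinf : (⨅ γ' ∈ Couplings μ ν, cost γ')
      = eLpNorm (fun p : Euc D × Euc D => p.2 - p.1) 2 γ ^ 2 := by
    rw [eLpNorm_snd_sub_fst_sq]
    exact le_antisymm (iInf₂_le γ h.1) (le_iInf₂ h.2)
  rw [W2, hinf, ENNReal.toReal_pow, Real.sqrt_sq ENNReal.toReal_nonneg,
    ENNReal.ofReal_toReal (memLp_snd_sub_fst h.1).eLpNorm_ne_top]

lemma W2_nonneg (μ ν : PM2 D) : 0 ≤ W2 μ ν := Real.sqrt_nonneg _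

lemma swap_mem_couplings {μ ν : PM2 D} {γ : Measure (Euc D × Euc D)} (h : γ ∈ Couplings μ ν) :
    γ.map Prod.swap ∈ Couplings ν μ := by
  constructor
  · rw [Measure.map_map measurable_fst measurable_swap]; exact h.2
  · rw [Measure.map_map measurable_snd measurable_swap]; exact h.1

lemma cost_map_swap (γ : Measure (Euc D × Euc D)) : cost (γ.map Prod.swap) = cost γ := by
  rw [cost, lintegral_map (by fun_prop) measurable_swap, cost]
  refine lintegral_congr fun p => ?_
  rw [← enorm_neg, neg_sub]; rfl

lemma W2_comm (μ ν : PM2 D) : W2 μ ν = W2 ν μ := by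
  have key (μ ν : PM2 D) : (⨅ γ ∈ Couplings μ ν, cost γ) ≤ ⨅ γ ∈ Couplings ν μ, cost γ :=
    le_iInf₂ fun γ hγ => (iInf₂_le _ (swap_mem_couplings hγ)).trans_eq (cost_map_swap γ)
  rw [W2, W2, le_antisymm (key μ ν) (key ν μ)]

lemma W2_self (μ : PM2 D) : W2 μ μ = 0 := by
  have hmem : μ.meas.map (fun x => (x, x)) ∈ Couplings μ μ := by
    constructor
    · rw [Measure.map_map measurable_fst (by fun_prop)]; exact Measure.map_id
    · rw [Measure.map_map measurable_snd (by fun_prop)]; exact Measure.map_id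
  have hcost : cost (μ.meas.map (fun x => (x, x))) = 0 := by
    rw [cost, lintegral_map (by fun_prop) (by fun_prop)]; simp
  rw [W2, le_antisymm ((iInf₂_le _ hmem).trans_eq hcost) zero_le]
  simp

/-! ### Lipschitz estimate for the field of a regular form -/

lemma PseudoOneForm.memLp_field (Λ : PseudoOneForm D) (μ : PM2 D) :
    MemLp (fun x => Λ.field μ x) 2 μ.meas := Lp.memLp _

/-- The field `A` of a regular form is Lipschitz at every `μ` along optimal couplings, uniformly on
bounded sets: both the linear term `B (y - x)`, `B` being essentially bounded, and the remainder
are at most a multiple of `W2 μ ν`. -/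
lemma PseudoOneForm.IsRegular.exists_eLpNorm_sub_le {Λ : PseudoOneForm D} (hΛ : Λ.IsRegular)
    (μ : PM2 D) (R : ℝ) :
    ∃ C : ℝ≥0, ∀ ν : PM2 D, W2 μ ν ≤ R → ∀ γ ∈ OptCouplings μ ν,
      eLpNorm (fun p : Euc D × Euc D => Λ.field ν p.2 - Λ.field μ p.1) 2 γ
        ≤ C * ENNReal.ofReal (W2 μ ν) := by
  obtain ⟨c, hc, h⟩ := hΛ
  obtain ⟨B, O, hBm, hB, -, hO, -, hreg⟩ := h μ
  -- `O` may be negative, so `min (O w) c` is not bounded by `c` in absolute value, and the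
  -- boundedness of `O` on `[0, R]` is needed
  obtain ⟨M, hM⟩ := (isCompact_Icc (a := (0 : ℝ)) (b := R)).exists_bound_of_continuousOn
    (f := fun w => min (O w) c) (by fun_prop)
  set K : ℝ≥0 := (eLpNorm B ∞ μ.meas).toNNReal
  refine ⟨M.toNNReal + K, fun ν hν γ hγ => ?_⟩
  have hfst := measurePreserving_fst hγ.1
  have hsnd := measurePreserving_snd hγ.1
  have hlin_meas : AEStronglyMeasurable (fun p : Euc D × Euc D => B p.1 (p.2 - p.1)) γ := by
    have : Measurable fun p : Euc D × Euc D => B p.1 (p.2 - p.1) :=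
      (isBoundedBilinearMap_apply (𝕜 := ℝ) (E := Euc D) (F := Euc D)).continuous.measurable.comp
        ((hBm.comp measurable_fst).prodMk (measurable_snd.sub measurable_fst))
    exact this.aestronglyMeasurable
  have hlin : eLpNorm (fun p : Euc D × Euc D => B p.1 (p.2 - p.1)) 2 γ
      ≤ K * ENNReal.ofReal (W2 μ ν) := by
    rw [← eLpNorm_snd_sub_fst_of_mem_optCouplings hγ]
    refine (eLpNorm_le_nnreal_smul_eLpNorm_of_ae_le_mul (c := K) ?_ 2).trans_eq
      (by rw [ENNReal.smul_def, smul_eq_mul])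
    have hae : ∀ᵐ x ∂μ.meas, ‖B x‖ₑ ≤ K := by
      rw [ENNReal.coe_toNNReal hB.eLpNorm_ne_top, eLpNorm_exponent_top]
      exact ae_le_eLpNormEssSup
    filter_upwards [hfst.quasiMeasurePreserving.ae hae] with p hp
    exact ((B p.1).le_opNNNorm _).trans (by gcongr; simpa [enorm] using hp)
  have hrem : eLpNorm (fun p : Euc D × Euc D =>
      Λ.field ν p.2 - Λ.field μ p.1 - B p.1 (p.2 - p.1)) 2 γ
      ≤ M.toNNReal * ENNReal.ofReal (W2 μ ν) := by
    have h1 := hreg ν γ hγ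
    rw [← eLpNorm_two_sq, ← mul_pow, ← sq_abs, ENNReal.ofReal_pow (abs_nonneg _)] at h1
    refine ((ENNReal.pow_right_strictMono two_ne_zero).le_iff_le.1 h1).trans ?_
    rw [abs_mul, abs_of_nonneg (W2_nonneg μ ν), mul_comm, ENNReal.ofReal_mul (abs_nonneg _)]
    gcongr
    exact ENNReal.ofReal_le_ofReal (hM _ ⟨W2_nonneg μ ν, hν⟩)
  have hdiff : AEStronglyMeasurable
      (fun p : Euc D × Euc D => Λ.field ν p.2 - Λ.field μ p.1) γ :=
    ((Λ.memLp_field ν).1.comp_measurePreserving hsnd).sub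
      ((Λ.memLp_field μ).1.comp_measurePreserving hfst)
  calc eLpNorm (fun p : Euc D × Euc D => Λ.field ν p.2 - Λ.field μ p.1) 2 γ
      = eLpNorm ((fun p : Euc D × Euc D =>
          Λ.field ν p.2 - Λ.field μ p.1 - B p.1 (p.2 - p.1))
          + fun p : Euc D × Euc D => B p.1 (p.2 - p.1)) 2 γ := by
        congr 1; ext1 p; simp
    _ ≤ M.toNNReal * ENNReal.ofReal (W2 μ ν) + K * ENNReal.ofReal (W2 μ ν) :=
        (eLpNorm_add_le (hdiff.sub hlin_meas) hlin_meas (by norm_num)).trans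
          (add_le_add hrem hlin)
    _ = _ := by rw [ENNReal.coe_add, add_mul]

/-- The norm of a regular form is bounded on every ball of the Wasserstein space. -/
lemma PseudoOneForm.IsRegular.exists_eLpNorm_field_le {Λ : PseudoOneForm D} (hΛ : Λ.IsRegular)
    (μ : PM2 D) (R : ℝ) :
    ∃ C : ℝ≥0, ∀ ν : PM2 D, W2 μ ν ≤ R → eLpNorm (Λ.field ν) 2 ν.meas ≤ C := by
  obtain ⟨C, hC⟩ := hΛ.exists_eLpNorm_sub_le μ R
  refine ⟨C * R.toNNReal + (eLpNorm (Λ.field μ) 2 μ.meas).toNNReal, fun ν hν => ?_⟩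
  obtain ⟨γ, hγ⟩ := exists_mem_optCouplings μ ν
  have hfst := measurePreserving_fst hγ.1
  have hsnd := measurePreserving_snd hγ.1
  have hmμ := (Λ.memLp_field μ).1.comp_measurePreserving hfst
  have hmν := (Λ.memLp_field ν).1.comp_measurePreserving hsnd
  rw [ENNReal.coe_add, ENNReal.coe_toNNReal (Λ.memLp_field μ).eLpNorm_ne_top,
    ← eLpNorm_comp_measurePreserving (Λ.memLp_field ν).1 hsnd,
    ← eLpNorm_comp_measurePreserving (Λ.memLp_field μ).1 hfst]
  calc eLpNorm (Λ.field ν ∘ Prod.snd) 2 γ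
      = eLpNorm ((fun p : Euc D × Euc D => Λ.field ν p.2 - Λ.field μ p.1)
          + (Λ.field μ ∘ Prod.fst)) 2 γ := by
        congr 1; ext1 p; simp
    _ ≤ _ := eLpNorm_add_le (hmν.sub hmμ) hmμ (by norm_num)
    _ ≤ _ := by
        gcongr
        refine (hC ν hν γ hγ).trans ?_
        rw [ENNReal.coe_mul]
        gcongr
        exact ENNReal.ofReal_le_ofReal hν

/-- The functional is controlled by the norm of its representative, by Cauchy-Schwarz; for fields
that are not in `L²` the value is `0`. -/
lemma PseudoOneForm.enorm_eval_le (Λ : PseudoOneForm D) (μ : PM2 D) (X : Euc D → Euc D) :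
    ‖Λ.eval μ X‖ₑ ≤ eLpNorm (Λ.field μ) 2 μ.meas * eLpNorm X 2 μ.meas := by
  unfold PseudoOneForm.eval
  split_ifs with h
  · have hn : ‖Λ μ‖ = ‖Λ.field μ‖ := by simp [PseudoOneForm.field]
    have h1 : ‖Λ μ (h.toLp X)‖ₑ ≤ ‖Λ.field μ‖ₑ * ‖h.toLp X‖ₑ := by
      have := (Λ μ).le_opENorm (h.toLp X)
      rwa [← ofReal_norm (Λ μ), hn, ofReal_norm] at this
    rwa [Lp.enorm_def, Lp.enorm_def, eLpNorm_congr_ae h.coeFn_toLp] at h1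
  · simp

lemma PseudoOneForm.eval_eq_integral (Λ : PseudoOneForm D) (μ : PM2 D) {X : Euc D → Euc D}
    (h : MemLp X 2 μ.meas) : Λ.eval μ X = ∫ x, inner ℝ (Λ.field μ x) (X x) ∂μ.meas := by
  have h1 : Λ μ (h.toLp X) = inner ℝ (Λ.field μ) (h.toLp X) := by
    simp [PseudoOneForm.field]
  rw [PseudoOneForm.eval, dif_pos h, h1, L2.inner_def]
  refine integral_congr_ae ?_
  filter_upwards [h.coeFn_toLp] with x hx
  rw [hx]

/-! ### Measurability of sections that vary continuously along couplings -/

section TransportContinuous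

variable {T X E : Type*} [TopologicalSpace T]
  [NormedAddCommGroup X] [MeasurableSpace X] [BorelSpace X]
  [NormedAddCommGroup E] [NormedSpace ℝ E]

/-- A family of vector-valued functions `A t` in `L²(ρ t)` is continuous along couplings if, for
every `t₀` and `t`, there is a coupling of `ρ t₀` and `ρ t` with respect to which `y` tends to `x`
and `A t y` tends to `A t₀ x` in `L²` as `t → t₀`. This compares elements of different `L²` spaces.
-/
structure TransportContinuous (ρ : T → Measure X) (A : T → X → E) : Prop where
  memLp : ∀ t, MemLp (A t) 2 (ρ t)
  exists_coupling : ∀ t₀, ∃ γ : T → Measure (X × X),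
    (∀ t, MeasurePreserving Prod.fst (γ t) (ρ t₀)) ∧
    (∀ t, MeasurePreserving Prod.snd (γ t) (ρ t)) ∧
    Tendsto (fun t => eLpNorm (fun p : X × X => p.2 - p.1) 2 (γ t)) (𝓝 t₀) (𝓝 0) ∧
    Tendsto (fun t => eLpNorm (fun p : X × X => A t p.2 - A t₀ p.1) 2 (γ t)) (𝓝 t₀) (𝓝 0)

/-- Testing against a bounded Lipschitz function yields a continuous function of `t`: under the
coupling, `φ(y) A_t(y) - φ(x) A_{t₀}(x)` is the sum of `φ(y) (A_t(y) - A_{t₀}(x))` and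
`(φ(y) - φ(x)) A_{t₀}(x)`. -/
lemma TransportContinuous.continuous_integral_smul {ρ : T → Measure X}
    [∀ t, IsProbabilityMeasure (ρ t)] {A : T → X → E} (hA : TransportContinuous ρ A)
    {φ : X → ℝ} {L : ℝ≥0} (hφ : LipschitzWith L φ) (hφ1 : ∀ x, ‖φ x‖ ≤ 1) :
    Continuous fun t => ∫ x, φ x • A t x ∂ρ t := by
  rw [continuous_iff_continuousAt]
  intro t₀
  obtain ⟨γ, hfst, hsnd, hγ, hAγ⟩ := hA.exists_coupling t₀
  have hφm : Measurable φ := hφ.continuous.measurable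
  have hint (t : T) : MemLp (fun x => φ x • A t x) 2 (ρ t) :=
    (hA.memLp t).of_le (hφm.aestronglyMeasurable.smul (hA.memLp t).1)
      (ae_of_all _ fun x => by
        rw [norm_smul]; exact mul_le_of_le_one_left (norm_nonneg _) (hφ1 x))
  refine tendsto_iff_edist_tendsto_0.2 ?_
  have hlim : Tendsto (fun t => eLpNorm (fun p : X × X => A t p.2 - A t₀ p.1) 2 (γ t)
      + L * eLpNorm (A t₀) 2 (ρ t₀) * eLpNorm (fun p : X × X => p.2 - p.1) 2 (γ t))
      (𝓝 t₀) (𝓝 0) := by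
    have := hAγ.add (ENNReal.Tendsto.const_mul (a := L * eLpNorm (A t₀) 2 (ρ t₀)) hγ
      (Or.inr (ENNReal.mul_ne_top ENNReal.coe_ne_top (hA.memLp t₀).eLpNorm_ne_top)))
    simpa using this
  refine tendsto_of_tendsto_of_tendsto_of_le_of_le tendsto_const_nhds hlim (fun _ => zero_le)
    fun t => ?_
  have : IsProbabilityMeasure (γ t) := by
    have : IsProbabilityMeasure ((γ t).map Prod.fst) := by rw [(hfst t).map_eq]; infer_instance
    exact Measure.isProbabilityMeasure_of_map Prod.fst
  have hA0 := (hA.memLp t₀).1.comp_measurePreserving (hfst t)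
  have hAt := (hA.memLp t).1.comp_measurePreserving (hsnd t)
  have hdiff : AEStronglyMeasurable (fun p : X × X => A t p.2 - A t₀ p.1) (γ t) := hAt.sub hA0
  have hmeas1 : AEStronglyMeasurable (fun p : X × X => φ p.2 • (A t p.2 - A t₀ p.1)) (γ t) :=
    (hφm.comp measurable_snd).aestronglyMeasurable.smul hdiff
  have hmeas2 : AEStronglyMeasurable (fun p : X × X => (φ p.2 - φ p.1) • A t₀ p.1) (γ t) :=
    ((hφm.comp measurable_snd).sub (hφm.comp measurable_fst)).aestronglyMeasurable.smul hA0
  have h1 : ∫ x, φ x • A t₀ x ∂ρ t₀ = ∫ p, φ p.1 • A t₀ p.1 ∂γ t := by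
    rw [← (hfst t).map_eq]
    exact integral_map (by fun_prop) (by rw [(hfst t).map_eq]; exact (hint t₀).1)
  have h2 : ∫ x, φ x • A t x ∂ρ t = ∫ p, φ p.2 • A t p.2 ∂γ t := by
    rw [← (hsnd t).map_eq]
    exact integral_map (by fun_prop) (by rw [(hsnd t).map_eq]; exact (hint t).1)
  have hi1 : Integrable (fun p : X × X => φ p.1 • A t₀ p.1) (γ t) :=
    ((hint t₀).comp_measurePreserving (hfst t)).integrable (by norm_num)
  have hi2 : Integrable (fun p : X × X => φ p.2 • A t p.2) (γ t) :=
    ((hint t).comp_measurePreserving (hsnd t)).integrable (by norm_num)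
  have hfirst : eLpNorm (fun p : X × X => φ p.2 • (A t p.2 - A t₀ p.1)) 1 (γ t)
      ≤ eLpNorm (fun p : X × X => A t p.2 - A t₀ p.1) 2 (γ t) := by
    refine (eLpNorm_mono fun p => ?_).trans
      (eLpNorm_le_eLpNorm_of_exponent_le (by norm_num) hdiff)
    rw [norm_smul]
    exact mul_le_of_le_one_left (norm_nonneg _) (hφ1 _)
  have hsecond : eLpNorm (fun p : X × X => (φ p.2 - φ p.1) • A t₀ p.1) 1 (γ t)
      ≤ L * eLpNorm (A t₀) 2 (ρ t₀) * eLpNorm (fun p : X × X => p.2 - p.1) 2 (γ t) := by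
    rw [← eLpNorm_comp_measurePreserving (hA.memLp t₀).1 (hfst t), mul_right_comm]
    refine (eLpNorm_smul_le_mul_eLpNorm (p := 2) (q := 2) (r := 1) hA0
      ((hφm.comp measurable_snd).sub (hφm.comp measurable_fst)).aestronglyMeasurable).trans ?_
    gcongr
    refine (eLpNorm_le_nnreal_smul_eLpNorm_of_ae_le_mul (c := L)
      (g := fun p : X × X => p.2 - p.1) (ae_of_all _ fun p => ?_) 2).trans_eq
      (by rw [ENNReal.smul_def, smul_eq_mul])
    simpa [← nndist_eq_nnnorm] using hφ.nndist_le p.2 p.1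
  beta_reduce
  rw [h1, h2, edist_eq_enorm_sub, ← integral_sub hi2 hi1]
  calc ‖∫ p, (φ p.2 • A t p.2 - φ p.1 • A t₀ p.1) ∂γ t‖ₑ
      ≤ eLpNorm (fun p : X × X => φ p.2 • A t p.2 - φ p.1 • A t₀ p.1) 1 (γ t) := by
        rw [eLpNorm_one_eq_lintegral_enorm]; exact enorm_integral_le_lintegral_enorm _
    _ = eLpNorm ((fun p : X × X => φ p.2 • (A t p.2 - A t₀ p.1))
          + fun p : X × X => (φ p.2 - φ p.1) • A t₀ p.1) 1 (γ t) := by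
        congr 1; ext1 p; simp only [Pi.add_apply, smul_sub, sub_smul]; abel
    _ ≤ _ := (eLpNorm_add_le hmeas1 hmeas2 le_rfl).trans (add_le_add hfirst hsecond)

variable [MeasurableSpace T] [OpensMeasurableSpace T] [MeasurableSpace E] [BorelSpace E]
  [SecondCountableTopology E]

/-- The vector measures `A t • ρ t` depend measurably on `t`. For a closed set, the
integral is the limit of the integrals against thickened indicators, which are continuous in `t`;
the general case follows by the π-λ theorem. -/
lemma TransportContinuous.measurable_setIntegral {ρ : T → Measure X}
    [∀ t, IsProbabilityMeasure (ρ t)] {A : T → X → E} (hA : TransportContinuous ρ A)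
    {S : Set (T × X)} (hS : MeasurableSet S) :
    Measurable fun t => ∫ x in Prod.mk t ⁻¹' S, A t x ∂ρ t := by
  have hint (t : T) : Integrable (A t) (ρ t) := (hA.memLp t).integrable (by norm_num)
  have hclosed {F : Set X} (hF : IsClosed F) : Measurable fun t => ∫ x in F, A t x ∂ρ t := by
    have hpos (n : ℕ) : (0 : ℝ) < 1 / ((n : ℝ) + 1) := by positivity
    refine measurable_of_tendsto_metrizable (f := fun n t =>
      ∫ x, ((thickenedIndicator (hpos n) F x : ℝ≥0) : ℝ) • A t x ∂ρ t) (fun n => ?_) ?_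
    · exact (hA.continuous_integral_smul
        (lipschitzWith_iff_dist_le_mul.2 fun x y =>
          (lipschitzWith_thickenedIndicator (hpos n) F).dist_le_mul x y)
        fun x => by simpa using thickenedIndicator_le_one (hpos n) F x).measurable
    · rw [tendsto_pi_nhds]
      intro t
      rw [← integral_indicator hF.measurableSet]
      refine tendsto_integral_of_dominated_convergence (fun x => ‖A t x‖) (fun n => ?_)
        (hint t).norm (fun n => ae_of_all _ fun x => ?_) (ae_of_all _ fun x => ?_)
      · exact (by fun_prop : AEStronglyMeasurable
          (fun x => ((thickenedIndicator (hpos n) F x : ℝ≥0) : ℝ)) (ρ t)).smul (hint t).1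
      · rw [norm_smul]
        exact mul_le_of_le_one_left (norm_nonneg _)
          (by simpa using thickenedIndicator_le_one (hpos n) F x)
      · have h1 := tendsto_pi_nhds.1 (thickenedIndicator_tendsto_indicator_closure hpos
          tendsto_one_div_add_atTop_nhds_zero_nat F) x
        have h2 : Tendsto (fun n => ((thickenedIndicator (hpos n) F x : ℝ≥0) : ℝ)) atTop
            (𝓝 ((indicator (closure F) (fun _ => (1 : ℝ≥0)) x : ℝ≥0) : ℝ)) :=
          (NNReal.continuous_coe.tendsto _).comp h1
        have h3 := h2.smul_const (A t x)
        rw [hF.closure_eq] at h3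
        convert h3 using 2
        by_cases hx : x ∈ F <;> simp [hx]
  have hgen : (Prod.instMeasurableSpace : MeasurableSpace (T × X)) = MeasurableSpace.generateFrom
      (image2 (· ×ˢ ·) {s : Set T | MeasurableSet s} {F : Set X | IsClosed F}) :=
    (generateFrom_eq_prod MeasurableSpace.generateFrom_measurableSet
      (borel_eq_generateFrom_isClosed.symm.trans BorelSpace.measurable_eq.symm)
      isCountablySpanning_measurableSet ⟨fun _ => univ, fun _ => isClosed_univ, iUnion_const _⟩).symm
  induction S, hS using MeasurableSpace.induction_on_inter hgen
    (MeasurableSpace.isPiSystem_measurableSet.prod isPiSystem_isClosed) with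
  | empty => simp
  | basic S hS =>
    obtain ⟨s, hs, F, hF, rfl⟩ := hS
    have : (fun t => ∫ x in Prod.mk t ⁻¹' (s ×ˢ F), A t x ∂ρ t)
        = s.indicator fun t => ∫ x in F, A t x ∂ρ t := by
      ext t
      by_cases ht : t ∈ s
      · simp [ht, mk_preimage_prod_right]
      · simp [ht, mk_preimage_prod_right_eq_empty]
    rw [this]
    exact (hclosed hF).indicator hs
  | compl S hS ih =>
    have : (fun t => ∫ x in Prod.mk t ⁻¹' Sᶜ, A t x ∂ρ t)
        = fun t => ∫ x in univ, A t x ∂ρ t - ∫ x in Prod.mk t ⁻¹' S, A t x ∂ρ t := by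
      ext t
      rw [setIntegral_univ, preimage_compl, setIntegral_compl (measurable_prodMk_left hS) (hint t)]
    rw [this]
    exact (hclosed isClosed_univ).sub ih
  | iUnion S hd hS ih =>
    refine measurable_of_tendsto_metrizable (f := fun n t =>
      ∑ i ∈ Finset.range n, ∫ x in Prod.mk t ⁻¹' S i, A t x ∂ρ t)
      (fun n => Finset.measurable_fun_sum _ fun i _ => ih i) ?_
    rw [tendsto_pi_nhds]
    intro t
    rw [preimage_iUnion]
    exact (hasSum_integral_iUnion (fun i => measurable_prodMk_left (hS i))
      (fun i j hij => (hd hij).preimage _) (hint t).integrableOn).tendsto_sum_nat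

/-- If the constant function `1` is continuous along couplings, then `ρ` is a kernel. -/
lemma TransportContinuous.measurable_measure {ρ : T → Measure X}
    [∀ t, IsProbabilityMeasure (ρ t)] (h : TransportContinuous ρ fun _ _ => (1 : ℝ)) :
    Measurable ρ := by
  refine Measure.measurable_of_measurable_coe _ fun U hU => ?_
  have h1 := (h.measurable_setIntegral (MeasurableSet.univ.prod hU)).ennreal_ofReal
  simpa [measureReal_def] using h1

end TransportContinuous

section InnerProduct

variable {T X E : Type*} [TopologicalSpace T] [MeasurableSpace T] [OpensMeasurableSpace T]
  [NormedAddCommGroup X] [MeasurableSpace X] [BorelSpace X]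
  [NormedAddCommGroup E] [InnerProductSpace ℝ E] [CompleteSpace E]
  [MeasurableSpace E] [BorelSpace E] [SecondCountableTopology E]

/-- The pairing of a section with a simple function is a finite sum of integrals over sections of
measurable sets. -/
lemma TransportContinuous.measurable_integral_inner_simpleFunc {ρ : T → Measure X}
    [∀ t, IsProbabilityMeasure (ρ t)] {A : T → X → E} (hA : TransportContinuous ρ A)
    (F : SimpleFunc (T × X) E) : Measurable fun t => ∫ x, inner ℝ (A t x) (F (t, x)) ∂ρ t := by
  have hint (t : T) : Integrable (A t) (ρ t) := (hA.memLp t).integrable (by norm_num)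
  have key (t : T) : ∫ x, inner ℝ (A t x) (F (t, x)) ∂ρ t
      = ∑ y ∈ F.range, inner ℝ y (∫ x in Prod.mk t ⁻¹' (F ⁻¹' {y}), A t x ∂ρ t) := by
    have hm (y : E) : MeasurableSet (Prod.mk t ⁻¹' (F ⁻¹' {y})) :=
      measurable_prodMk_left (F.measurableSet_fiber y)
    have hpt (x : X) : inner ℝ (A t x) (F (t, x)) = ∑ y ∈ F.range,
        (Prod.mk t ⁻¹' (F ⁻¹' {y})).indicator (fun x => inner ℝ y (A t x)) x := by
      rw [Finset.sum_eq_single_of_mem (F (t, x)) (F.mem_range_self _)]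
      · rw [indicator_of_mem (by simp), real_inner_comm]
      · intro y _ hy
        exact indicator_of_notMem (fun h => hy (by simpa using h.symm)) _
    simp_rw [hpt]
    rw [integral_finsetSum _ fun y _ => ((hint t).const_inner y).indicator (hm y)]
    refine Finset.sum_congr rfl fun y _ => ?_
    rw [integral_indicator (hm y), integral_inner (hint t).integrableOn]
  simp_rw [key]
  exact Finset.measurable_fun_sum _ fun y _ =>
    (hA.measurable_setIntegral (F.measurableSet_fiber y)).const_inner

/-- The pairing of a section with a jointly measurable field, where the latter is in `L²`, is
measurable, by approximation with simple functions dominated by twice the field. -/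
lemma TransportContinuous.measurable_indicator_integral_inner {ρ : T → Measure X}
    [∀ t, IsProbabilityMeasure (ρ t)] {A : T → X → E} (hA : TransportContinuous ρ A)
    {f : T × X → E} (hf : Measurable f)
    (hmem : MeasurableSet {t | MemLp (fun x => f (t, x)) 2 (ρ t)}) :
    Measurable ({t | MemLp (fun x => f (t, x)) 2 (ρ t)}.indicator
      fun t => ∫ x, inner ℝ (A t x) (f (t, x)) ∂ρ t) := by
  let F (n : ℕ) : SimpleFunc (T × X) E := SimpleFunc.approxOn f hf univ 0 (mem_univ 0) n
  refine measurable_of_tendsto_metrizable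
    (f := fun n => {t | MemLp (fun x => f (t, x)) 2 (ρ t)}.indicator
      fun t => ∫ x, inner ℝ (A t x) (F n (t, x)) ∂ρ t)
    (fun n => (hA.measurable_integral_inner_simpleFunc (F n)).indicator hmem) ?_
  rw [tendsto_pi_nhds]
  intro t
  by_cases ht : MemLp (fun x => f (t, x)) 2 (ρ t)
  · simp only [indicator, mem_ofPred_eq, ht, if_true]
    refine tendsto_integral_of_dominated_convergence
      (fun x => ‖A t x‖ * (‖f (t, x)‖ + ‖f (t, x)‖)) (fun n => ?_) ?_
      (fun n => ae_of_all _ fun x => ?_) (ae_of_all _ fun x => ?_)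
    · exact (hA.memLp t).1.inner
        ((F n).measurable.comp measurable_prodMk_left).aestronglyMeasurable
    · exact (hA.memLp t).norm.integrable_mul (ht.norm.add ht.norm)
    · refine (norm_inner_le_norm _ _).trans ?_
      gcongr
      exact SimpleFunc.norm_approxOn_zero_le hf (mem_univ 0) (t, x) n
    · exact tendsto_const_nhds.inner (SimpleFunc.tendsto_approxOn hf (mem_univ 0) (by simp))
  · simp [indicator, ht]

end InnerProduct

/-! ### Regular forms along absolutely continuous curves -/

/-- The distance from a point of a 2-absolutely continuous curve is dominated by a function that is
continuous up to the endpoints, the absolute value of a primitive of the metric speed. -/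
lemma IsAC2.exists_continuousOn_W2_le {a b : ℝ} {σ : ℝ → PM2 D} (hσ : IsAC2 a b σ) {t₀ : ℝ}
    (ht₀ : t₀ ∈ Ioo a b) :
    ∃ g : ℝ → ℝ, ContinuousOn g (Icc a b) ∧ g t₀ = 0 ∧
      ∀ t ∈ Ioo a b, W2 (σ t₀) (σ t) ≤ g t := by
  obtain ⟨β, hβ, hW⟩ := hσ
  have hab : a < b := ht₀.1.trans ht₀.2
  have hint : IntervalIntegrable β volume a b :=
    (intervalIntegrable_iff_integrableOn_Ioo_of_le hab.le).2 (hβ.integrable (by norm_num))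
  refine ⟨fun t => |∫ τ in t₀..t, β τ|, ?_, by simp, fun t ht => ?_⟩
  · rw [← uIcc_of_le hab.le]
    refine (intervalIntegral.continuousOn_primitive_interval' hint ?_).abs
    rw [uIcc_of_le hab.le]
    exact Ioo_subset_Icc_self ht₀
  · rcases lt_trichotomy t t₀ with h | rfl | h
    · beta_reduce
      rw [intervalIntegral.integral_symm, abs_neg]
      exact (hW t t₀ ht.1 h ht₀.2).trans (le_abs_self _)
    · simp [W2_self]
    · rw [W2_comm]
      exact (hW t₀ t ht₀.1 h ht.2).trans (le_abs_self _)

/-- The curve stays in a ball, because the speed is integrable on the bounded interval. -/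
lemma IsAC2.exists_W2_le {a b : ℝ} {σ : ℝ → PM2 D} (hσ : IsAC2 a b σ) {t₀ : ℝ}
    (ht₀ : t₀ ∈ Ioo a b) : ∃ R : ℝ, ∀ t ∈ Ioo a b, W2 (σ t₀) (σ t) ≤ R := by
  obtain ⟨g, hg, -, hW⟩ := hσ.exists_continuousOn_W2_le ht₀
  obtain ⟨R, hR⟩ := isCompact_Icc.exists_bound_of_continuousOn hg
  exact ⟨R, fun t ht => (hW t ht).trans ((le_abs_self _).trans (hR t (Ioo_subset_Icc_self ht)))⟩

lemma IsAC2.tendsto_W2 {a b : ℝ} {σ : ℝ → PM2 D} (hσ : IsAC2 a b σ) (t₀ : Ioo a b) :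
    Tendsto (fun t : Ioo a b => W2 (σ t₀) (σ t)) (𝓝 t₀) (𝓝 0) := by
  obtain ⟨g, hg, hg0, hW⟩ := hσ.exists_continuousOn_W2_le t₀.2
  have hg' : Tendsto (fun t : Ioo a b => g t) (𝓝 t₀) (𝓝 (g t₀)) :=
    (continuousOn_iff_continuous_domRestrict.1 (hg.mono Ioo_subset_Icc_self)).continuousAt
  rw [hg0] at hg'
  exact squeeze_zero (fun t => W2_nonneg _ _) (fun t => hW t t.2) hg'

/-- A section satisfying a local Lipschitz estimate along optimal couplings is continuous along
couplings on every absolutely continuous curve. -/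
lemma IsAC2.transportContinuous {E : Type*} [NormedAddCommGroup E] {a b : ℝ} {σ : ℝ → PM2 D}
    (hσ : IsAC2 a b σ) {A : (μ : PM2 D) → Euc D → E} (hA : ∀ μ, MemLp (A μ) 2 μ.meas)
    (hlip : ∀ (μ : PM2 D) (R : ℝ), ∃ C : ℝ≥0, ∀ ν : PM2 D, W2 μ ν ≤ R → ∀ γ ∈ OptCouplings μ ν,
      eLpNorm (fun p : Euc D × Euc D => A ν p.2 - A μ p.1) 2 γ
        ≤ C * ENNReal.ofReal (W2 μ ν)) :
    TransportContinuous (fun t : Ioo a b => (σ t).meas) fun t => A (σ t) := by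
  refine ⟨fun t => hA _, fun t₀ => ?_⟩
  choose γ hγ using fun t : Ioo a b => exists_mem_optCouplings (σ t₀) (σ t)
  obtain ⟨R, hR⟩ := hσ.exists_W2_le t₀.2
  obtain ⟨C, hC⟩ := hlip (σ t₀) R
  have hW : Tendsto (fun t : Ioo a b => ENNReal.ofReal (W2 (σ t₀) (σ t))) (𝓝 t₀) (𝓝 0) := by
    simpa using ENNReal.tendsto_ofReal (hσ.tendsto_W2 t₀)
  refine ⟨γ, fun t => measurePreserving_fst (hγ t).1, fun t => measurePreserving_snd (hγ t).1,
    ?_, ?_⟩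
  · simpa only [eLpNorm_snd_sub_fst_of_mem_optCouplings (hγ _)] using hW
  · have hCW := ENNReal.Tendsto.const_mul (a := (C : ℝ≥0∞)) hW (Or.inr ENNReal.coe_ne_top)
    rw [mul_zero] at hCW
    exact tendsto_of_tendsto_of_tendsto_of_le_of_le tendsto_const_nhds hCW (fun _ => zero_le)
      fun t => hC (σ t) (hR t t.2) (γ t) (hγ t)

lemma IsAC2.measurable_measure {a b : ℝ} {σ : ℝ → PM2 D} (hσ : IsAC2 a b σ) :
    Measurable fun t : Ioo a b => (σ t).meas :=
  (hσ.transportContinuous (A := fun _ _ => (1 : ℝ)) (fun _ => memLp_const 1)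
    fun _ _ => ⟨0, by simp⟩).measurable_measure

/-- Since `t ↦ σ t` is a kernel, the integral of `‖v t‖ ^ 2` depends measurably on `t`. -/
lemma IsAC2.measurable_eLpNorm {a b : ℝ} {σ : ℝ → PM2 D} (hσ : IsAC2 a b σ)
    {v : ℝ → Euc D → Euc D} (hv : Measurable fun p : Ioo a b × Euc D => v p.1 p.2) :
    Measurable fun t : Ioo a b => eLpNorm (v t) 2 (σ t).meas := by
  let κ : ProbabilityTheory.Kernel (Ioo a b) (Euc D) :=
    ⟨fun t => (σ t).meas, hσ.measurable_measure⟩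
  have : ProbabilityTheory.IsMarkovKernel κ := ⟨fun t => (inferInstance :
    IsProbabilityMeasure (σ t).meas)⟩
  have h : Measurable fun t : Ioo a b => ∫⁻ x, ‖v t x‖ₑ ^ 2 ∂(σ t).meas :=
    Measurable.lintegral_kernel_prod_right' (κ := κ) (f := fun p => ‖v p.1 p.2‖ₑ ^ 2)
      (hv.enorm.pow_const 2)
  simpa [eLpNorm_eq_lintegral_rpow_enorm_toReal] using h.pow_const (1 / 2 : ℝ)

lemma PseudoOneForm.IsRegular.measurable_eval {Λ : PseudoOneForm D} (hΛ : Λ.IsRegular)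
    {a b : ℝ} {σ : ℝ → PM2 D} (hσ : IsAC2 a b σ) {v : ℝ → Euc D → Euc D}
    (hv : Measurable fun p : Ioo a b × Euc D => v p.1 p.2) :
    Measurable fun t : Ioo a b => Λ.eval (σ t) (v t) := by
  have hvt (t : Ioo a b) : Measurable (v t) := hv.comp measurable_prodMk_left
  have hmem : MeasurableSet {t : Ioo a b | MemLp (fun x => v t x) 2 (σ t).meas} := by
    have : {t : Ioo a b | MemLp (fun x => v t x) 2 (σ t).meas}
        = {t : Ioo a b | eLpNorm (v t) 2 (σ t).meas < ∞} := by
      ext t; exact ⟨fun h => h.2, fun h => ⟨(hvt t).aestronglyMeasurable, h⟩⟩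
    rw [this]
    exact measurableSet_lt (hσ.measurable_eLpNorm hv) measurable_const
  have key := (hσ.transportContinuous (A := fun μ => Λ.field μ) Λ.memLp_field
    hΛ.exists_eLpNorm_sub_le).measurable_indicator_integral_inner hv hmem
  convert key using 1
  ext t
  by_cases ht : MemLp (v t) 2 (σ t).meas
  · rw [indicator_of_mem (by exact ht), Λ.eval_eq_integral _ ht]
  · rw [indicator_of_notMem (by exact ht), PseudoOneForm.eval, dif_neg ht]

end WassersteinForms

open WassersteinForms in
theorem mainTheorem6 (D : ℕ) (Λ : WassersteinForms.PseudoOneForm D) (hΛ : Λ.IsRegular)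
    (a b : ℝ) (σ : ℝ → WassersteinForms.PM2 D) (hσ : WassersteinForms.IsAC2 a b σ)
    (v : ℝ → WassersteinForms.Euc D → WassersteinForms.Euc D)
    (hv : WassersteinForms.IsVelocity a b σ v)
    (hv2 : ∫⁻ t in Ioo a b, eLpNorm (v t) 2 (σ t).meas ^ 2 < ∞) :
    Measurable (fun t : Ioo a b => Λ.eval (σ t) (v t)) ∧
      MemLp (fun t => Λ.eval (σ t) (v t)) 2 (volume.restrict (Ioo a b)) ∧
      IntegrableOn (fun t => Λ.eval (σ t) (v t)) (Ioo a b) := by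
  have hmeas := hΛ.measurable_eval hσ hv.borel
  suffices h : MemLp (fun t => Λ.eval (σ t) (v t)) 2 (volume.restrict (Ioo a b)) from
    ⟨hmeas, h, h.integrable (by norm_num)⟩
  rcases (Ioo a b).eq_empty_or_nonempty with hempty | ⟨t₀, ht₀⟩
  · simp [hempty]
  obtain ⟨R, hR⟩ := hσ.exists_W2_le ht₀
  obtain ⟨C, hC⟩ := hΛ.exists_eLpNorm_field_le (σ t₀) R
  refine ⟨((aemeasurable_restrict_iff_comap_subtype measurableSet_Ioo).2
    hmeas.aemeasurable).aestronglyMeasurable, ?_⟩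
  have hlt : eLpNorm (fun t => Λ.eval (σ t) (v t)) 2 (volume.restrict (Ioo a b)) ^ 2 < ∞ := by
    rw [eLpNorm_two_sq]
    calc ∫⁻ t in Ioo a b, ‖Λ.eval (σ t) (v t)‖ₑ ^ 2
        ≤ ∫⁻ t in Ioo a b, (C : ℝ≥0∞) ^ 2 * eLpNorm (v t) 2 (σ t).meas ^ 2 := by
          refine setLIntegral_mono' measurableSet_Ioo fun t ht => ?_
          rw [← mul_pow]
          gcongr
          exact (Λ.enorm_eval_le _ _).trans (by gcongr; exact hC _ (hR t ht))
      _ = (C : ℝ≥0∞) ^ 2 * ∫⁻ t in Ioo a b, eLpNorm (v t) 2 (σ t).meas ^ 2 :=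
          lintegral_const_mul' _ _ (by finiteness)
      _ < ∞ := ENNReal.mul_lt_top (by finiteness) hv2
  simpa using hlt
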